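/- A \emph{Turing machine} is a deterministic machine with $k+1\ge 1$ two-way infinite tapes, finite tape alphabet $\Gamma$ (containing distinct symbols $0$, $1$ and blank), finite state set $Q$, a start state, and distinct accepting and rejecting states, in which it halts. Its input $x\in\{0,1\}^d$ is written on the first tape, everything else is blank, and every head starts at cell $0$, the cell of the first input bit. In one operation the machine reads the scanned symbols, changes its state, writes one symbol on each tape, and moves each head by at most one cell. It implements $f:\{0,1\}^d\to\{0,1\}$ using at most $t$ operations if on every $x\in\{0,1\}^d$ it halts after at most $t$ operations, accepting if $f(x)=1$ and rejecting if $f(x)=0$. A \emph{network architecture} is a layered feed-forward graph with $d$ inputs, a number of nonempty hidden layers and one output neuron, consecutive layers being completely connected (so that a missing edge is a zero weight). Its \emph{depth} is the number of layers (hidden layers and output layer), and its \emph{size} is the total number of neurons (input coordinates are not counted in either). Every neuron outputs $\sigma(\langle w,y\rangle+\beta)$, where $y$ is the vector of outputs of the previous layer, $w$ a real weight vector, $\beta$ a real bias, and $\sigma(z)=1$ if $z>0$, $\sigma(z)=0$ otherwise (threshold activation). Its \emph{hypothesis class} consists of all functions $\{0,1\}^d\to\{0,1\}$ obtained by choosing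 the weights and biases. \textbf{Theorem.} Let $T:\mathbb N\to\mathbb N$, and fix the number of tapes $k+1$, the finite tape alphabet $\Gamma$ and the finite state set $Q$. For every $d$, let $\mathcal F_d$ be the set of all functions $\{0,1\}^d\to\{0,1\}$ that are implemented by some Turing machine with $k+1$ tapes, alphabet $\Gamma$ and state set $Q$ using at most $T(d)$ operations. Then there exist positive integers $b,c$ such that for every $d$ there is a network architecture of depth exactly $c\,T(d)+b$ and size exactly $(c\,T(d)+b)^2$, with threshold activation function, whose hypothesis class contains $\mathcal F_d$. -/

import Mathlib

/-! Layered feed-forward neural networks. -/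

/-- The threshold activation function: `1` if `z > 0` and `0` otherwise. -/
noncomputable def thresholdActivation (z : ℝ) : ℝ := if 0 < z then 1 else 0

/-- The graph of a layered feed-forward network with a single output neuron, given by the numbers of
neurons of its successive hidden layers. Consecutive layers are completely connected (leaving an edge
out amounts to giving it the weight `0`). The input coordinates are not neurons. -/
structure NetworkArchitecture where
  hidden : List ℕ
  hidden_pos : ∀ n ∈ hidden, 0 < n

/-- The number of layers, counting the hidden layers and the output layer. -/
def NetworkArchitecture.depth (A : NetworkArchitecture) : ℕ := A.hidden.length + 1

/-- The number of neurons, counting the hidden neurons and the output neuron. -/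
def NetworkArchitecture.size (A : NetworkArchitecture) : ℕ := A.hidden.sum + 1

/-- Real weights and biases for a network with the given number of inputs and the given list of
hidden layer widths, listed from the first layer to the output neuron. -/
inductive NetworkWeights : ℕ → List ℕ → Type
  | output {m : ℕ} (w : Fin m → ℝ) (bias : ℝ) : NetworkWeights m []
  | layer {m n : ℕ} {L : List ℕ} (W : Fin n → Fin m → ℝ) (bias : Fin n → ℝ)
      (rest : NetworkWeights n L) : NetworkWeights m (n :: L)

/-- The function computed by a network: each neuron applies the activation function `σ` to the
weighted sum of the outputs of the previous layer plus its bias. -/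
noncomputable def NetworkWeights.eval (σ : ℝ → ℝ) :
    {m : ℕ} → {L : List ℕ} → NetworkWeights m L → (Fin m → ℝ) → ℝ
  | _, _, .output w bias, x => σ ((∑ j, w j * x j) + bias)
  | _, _, .layer W bias rest, x => rest.eval σ fun i => σ ((∑ j, W i j * x j) + bias i)

/-- A bit, as a real number. -/
def bitToReal (a : Bool) : ℝ := if a then 1 else 0

/-- The Boolean hypothesis class of an architecture with activation `σ`: all functions from `{0,1}^d`
to `{0,1}` that are obtained by some choice of the weights and biases. -/
def NetworkArchitecture.hypothesisClass (A : NetworkArchitecture) (σ : ℝ → ℝ) (d : ℕ) :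
    Set ((Fin d → Bool) → Bool) :=
  {f | ∃ N : NetworkWeights d A.hidden,
    ∀ x : Fin d → Bool, N.eval σ (fun i => bitToReal (x i)) = bitToReal (f x)}

/-! Deterministic multi-tape Turing machines. -/

/-- A head movement. -/
inductive HeadMove
  | left
  | stay
  | right

/-- The displacement of the head. -/
def HeadMove.shift : HeadMove → ℤ
  | .left => -1
  | .stay => 0
  | .right => 1

/-- A deterministic Turing machine with `k + 1` two-way infinite tapes, tape alphabet `Γ` and state
set `Q`. `symbol none` is the blank, `symbol (some false)` and `symbol (some true)` are the input
symbols `0` and `1`. -/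
structure TuringMachine (k : ℕ) (Γ Q : Type) where
  symbol : Option Bool ↪ Γ
  start : Q
  accept : Q
  reject : Q
  accept_ne_reject : accept ≠ reject
  transition : Q → (Fin (k + 1) → Γ) → Q × (Fin (k + 1) → Γ × HeadMove)

namespace TuringMachine

variable {k : ℕ} {Γ Q : Type}

/-- A configuration: state, head positions and tape contents. -/
structure Config (k : ℕ) (Γ Q : Type) where
  state : Q
  head : Fin (k + 1) → ℤ
  tape : Fin (k + 1) → ℤ → Γ

/-- Initially the cells `0, …, d - 1` of tape `0` hold the input, all other cells of all tapes are
blank, and every head is on cell `0`. -/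
def init (M : TuringMachine k Γ Q) {d : ℕ} (x : Fin d → Bool) : Config k Γ Q where
  state := M.start
  head := fun _ => 0
  tape := fun i p =>
    if h : i = 0 ∧ 0 ≤ p ∧ p < (d : ℤ) then M.symbol (some (x ⟨p.toNat, by omega⟩))
    else M.symbol none

open Classical in
/-- One operation: read the scanned symbols, change state, write on all tapes and move all heads.
Nothing happens once the accepting or the rejecting state is reached. -/
noncomputable def step (M : TuringMachine k Γ Q) (C : Config k Γ Q) : Config k Γ Q :=
  if C.state = M.accept ∨ C.state = M.reject then C
  else
    let r := M.transition C.state (fun i => C.tape i (C.head i))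
    { state := r.1
      head := fun i => C.head i + (r.2 i).2.shift
      tape := fun i => Function.update (C.tape i) (C.head i) (r.2 i).1 }

/-- On every input in `{0,1}^d` the machine halts after at most `t` operations, accepting if `f` is
`1` there and rejecting if `f` is `0` there. -/
def ComputesWithin (M : TuringMachine k Γ Q) {d : ℕ} (f : (Fin d → Bool) → Bool) (t : ℕ) : Prop :=
  ∀ x : Fin d → Bool, ∃ s ≤ t,
    (M.step^[s] (M.init x)).state = if f x then M.accept else M.reject

end TuringMachine

/-- The functions from `{0,1}^d` to `{0,1}` that are implemented by some Turing machine with `k + 1`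
tapes, alphabet `Γ` and state set `Q` using at most `T d` operations. -/
def turingFunctions (k : ℕ) (Γ Q : Type) (T : ℕ → ℕ) (d : ℕ) : Set ((Fin d → Bool) → Bool) :=
  {f | ∃ M : TuringMachine k Γ Q, M.ComputesWithin f (T d)}

/-! ### Affine spans of families of real functions -/

/-! A threshold network simulates the machine step by step. In `t` steps the heads stay within
distance `t` of the origin, so a configuration is encoded by O(t) bits, with head positions in
unary. One operation costs three layers: mark the scanned cell and its symbol (`isNeuron_cellBits`),
detect the pair of state and scanned tuple (`isNeuron_scanBits`), compute the new bits
(`isNeuron_configBits_step`). Only the weights depend on the machine, so one architecture serves all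
of them.

Since a neuron sees its inputs only through affine combinations, layers are compared by affine
spans. Hence `Realizes` tolerates surplus neurons, and copying layers supply the exact depth and
size. -/

/-- The `0`-`1`-valued function that indicates a predicate. -/
noncomputable def ind {X : Type*} (P : X → Prop) : X → ℝ :=
  open Classical in fun x => if P x then 1 else 0

theorem ind_of {X : Type*} {P : X → Prop} {x : X} (h : P x) : ind P x = 1 := if_pos h

theorem ind_of_not {X : Type*} {P : X → Prop} {x : X} (h : ¬P x) : ind P x = 0 := if_neg h

theorem ind_apply {X : Type*} (P : X → Prop) (x : X) [Decidable (P x)] :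
    ind P x = if P x then 1 else 0 := by
  by_cases h : P x
  · rw [ind_of h, if_pos h]
  · rw [ind_of_not h, if_neg h]

/-- The affine combinations of the members of a family of functions. -/
def affSpan {X ι : Type*} (g : ι → X → ℝ) : Submodule ℝ (X → ℝ) :=
  Submodule.span ℝ (insert 1 (Set.range g))

theorem mem_affSpan {X ι : Type*} (g : ι → X → ℝ) (i : ι) : g i ∈ affSpan g :=
  Submodule.subset_span (Set.mem_insert_of_mem _ ⟨i, rfl⟩)

theorem const_mem_affSpan {X ι : Type*} (g : ι → X → ℝ) (r : ℝ) :
    (fun _ => r) ∈ affSpan g := by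
  have h : (1 : X → ℝ) ∈ affSpan g := Submodule.subset_span (Set.mem_insert _ _)
  have := (affSpan g).smul_mem r h
  convert this using 1
  ext x
  simp

theorem ind_mem_affSpan_of_forall_iff {X ι : Type*} (g : ι → X → ℝ) (P : X → Prop) (R : Prop)
    (h : ∀ x, P x ↔ R) : ind P ∈ affSpan g := by
  classical
  have := const_mem_affSpan g (if R then 1 else 0)
  convert this using 1
  ext x
  simp [ind, h]

theorem affSpan_le {X ι : Type*} {g : ι → X → ℝ} {κ : Type*} {g' : κ → X → ℝ}
    (h : ∀ i, g i ∈ affSpan g') : affSpan g ≤ affSpan g' := by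
  refine Submodule.span_le.2 ?_
  rintro f (rfl | ⟨i, rfl⟩)
  · exact const_mem_affSpan g' 1
  · exact h i

theorem exists_weights_of_mem_affSpan {X ι : Type*} [Fintype ι] {g : ι → X → ℝ} {f : X → ℝ}
    (hf : f ∈ affSpan g) : ∃ (w : ι → ℝ) (b : ℝ), ∀ x, f x = (∑ j, w j * g j x) + b := by
  obtain ⟨b, z, hz, rfl⟩ := Submodule.mem_span_insert.1 hf
  obtain ⟨w, rfl⟩ := (Submodule.mem_span_range_iff_exists_fun ℝ).1 hz
  exact ⟨w, b, fun x => by simp [Finset.sum_apply, add_comm]⟩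

/-! ### Realizing functions by threshold networks -/

/-- `f` is a network with layers `L` applied to any inputs whose affine span contains that of `g`. -/
def Realizes {X ι : Type*} (g : ι → X → ℝ) (L : List ℕ) (f : X → ℝ) : Prop :=
  ∀ (m : ℕ) (G : Fin m → X → ℝ), affSpan g ≤ affSpan G →
    ∃ N : NetworkWeights m L, ∀ x, N.eval thresholdActivation (fun i => G i x) = f x

/-- `f` is the output of a threshold neuron with inputs `g`. -/
def IsNeuron {X ι : Type*} (g : ι → X → ℝ) (f : X → ℝ) : Prop :=
  ∃ l ∈ affSpan g, ∀ x, thresholdActivation (l x) = f x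

theorem isNeuron_ind {X ι : Type*} {g : ι → X → ℝ} {P : X → Prop} {l : X → ℝ}
    (hl : l ∈ affSpan g) (h : ∀ x, 0 < l x ↔ P x) : IsNeuron g (ind P) :=
  ⟨l, hl, fun x => by
    classical
    rw [thresholdActivation, ind_apply]
    exact if_congr (h x) rfl rfl⟩

theorem isNeuron_of_ind_mem {X ι : Type*} {g : ι → X → ℝ} {P : X → Prop}
    (h : ind P ∈ affSpan g) : IsNeuron g (ind P) := by
  refine isNeuron_ind (Submodule.sub_mem _ h (const_mem_affSpan g (1 / 2))) fun x => ?_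
  by_cases hP : P x <;> (simp [ind, hP]; try norm_num)

theorem IsNeuron.realizes {X ι : Type*} {g : ι → X → ℝ} {f : X → ℝ} (h : IsNeuron g f) :
    Realizes g [] f := by
  intro m G hG
  obtain ⟨l, hl, hf⟩ := h
  obtain ⟨w, b, hw⟩ := exists_weights_of_mem_affSpan (hG hl)
  exact ⟨.output w b, fun x => by rw [NetworkWeights.eval, ← hw, hf]⟩

theorem Realizes.cons {X ι κ : Type*} [Fintype κ] {g : ι → X → ℝ} {g' : κ → X → ℝ} {n : ℕ}
    {L : List ℕ} {f : X → ℝ} (hn : Fintype.card κ ≤ n) (hg : ∀ j, IsNeuron g (g' j))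
    (h : Realizes g' L f) : Realizes g (n :: L) f := by
  classical
  intro m G hG
  obtain ⟨e⟩ : Nonempty (κ ↪ Fin n) :=
    Function.Embedding.nonempty_of_card_le (by simpa using hn)
  choose l hl hlf using hg
  choose w b hw using fun j => exists_weights_of_mem_affSpan (hG (hl j))
  -- Surplus neurons get zero weights and bias; they only enlarge the span.
  let W : Fin n → Fin m → ℝ := Function.extend e w 0
  let B : Fin n → ℝ := Function.extend e b 0
  let G' : Fin n → X → ℝ := fun i x => thresholdActivation ((∑ j, W i j * G j x) + B i)
  have hG' : ∀ j, G' (e j) = g' j := by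
    intro j
    ext x
    simp only [G', W, B, e.injective.extend_apply]
    rw [← hw, hlf]
  obtain ⟨N, hN⟩ := h n G' (affSpan_le fun j => hG' j ▸ mem_affSpan G' (e j))
  exact ⟨.layer W B N, fun x => by rw [NetworkWeights.eval]; exact hN x⟩

/-! ### Configurations encoded by bits -/

namespace TuringMachine

variable {k : ℕ} {Γ Q X : Type}

/-- The positions at distance at most `T` from the origin. -/
abbrev Pos (T : ℕ) : Type := ↥(Finset.Icc (-(T : ℤ)) T)

/-- The symbols under the heads. -/
def Config.scan (C : Config k Γ Q) (i : Fin (k + 1)) : Γ := C.tape i (C.head i)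

/-- All heads are at distance at most `t` from the origin. -/
def Config.Within (t : ℕ) (C : Config k Γ Q) : Prop :=
  ∀ i, -(t : ℤ) ≤ C.head i ∧ C.head i ≤ t

/-- The state, the tapes in a window and the head positions (in unary) of a configuration that
depends on a parameter. -/
noncomputable def configBits (T : ℕ) (c : X → Config k Γ Q) :
    (Q ⊕ Fin (k + 1) × Pos T × Γ) ⊕ Fin (k + 1) × Pos T → X → ℝ
  | .inl (.inl q) => ind fun x => (c x).state = q
  | .inl (.inr (i, p, a)) => ind fun x => (c x).tape i p = a
  | .inr (i, p) => ind fun x => (c x).head i ≤ p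

/-- The bits of a configuration and, for each cell and symbol, whether that symbol is scanned in
that cell. -/
noncomputable def cellBits (T : ℕ) (c : X → Config k Γ Q) :
    ((Q ⊕ Fin (k + 1) × Pos T × Γ) ⊕ Fin (k + 1) × Pos T) ⊕ Fin (k + 1) × Pos T × Γ → X → ℝ
  | .inl v => configBits T c v
  | .inr (i, p, a) => ind fun x => (c x).tape i p = a ∧ (c x).head i = p

/-- The previous bits and, for each state and tuple of symbols, whether these are the current ones. -/
noncomputable def scanBits (T : ℕ) (c : X → Config k Γ Q) :
    (((Q ⊕ Fin (k + 1) × Pos T × Γ) ⊕ Fin (k + 1) × Pos T) ⊕ Fin (k + 1) × Pos T × Γ) ⊕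
      Q × (Fin (k + 1) → Γ) → X → ℝ
  | .inl v => cellBits T c v
  | .inr (q, s) => ind fun x => (c x).state = q ∧ (c x).scan = s

theorem exists_ind_configBits (T : ℕ) (c : X → Config k Γ Q) (v) :
    ∃ P : X → Prop, configBits T c v = ind P := by
  rcases v with (q | ⟨i, p, a⟩) | ⟨i, p⟩ <;> exact ⟨_, rfl⟩

theorem exists_ind_cellBits (T : ℕ) (c : X → Config k Γ Q) (v) :
    ∃ P : X → Prop, cellBits T c v = ind P := by
  rcases v with v | ⟨i, p, a⟩
  · exact exists_ind_configBits T c v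
  · exact ⟨_, rfl⟩

theorem configBits_le_cellBits (T : ℕ) (c : X → Config k Γ Q) :
    affSpan (configBits T c) ≤ affSpan (cellBits T c) :=
  affSpan_le fun v => mem_affSpan (cellBits T c) (.inl v)

theorem cellBits_le_scanBits (T : ℕ) (c : X → Config k Γ Q) :
    affSpan (cellBits T c) ≤ affSpan (scanBits T c) :=
  affSpan_le fun v => mem_affSpan (scanBits T c) (.inl v)

theorem ind_head_le_mem {T : ℕ} {c : X → Config k Γ Q} (hc : ∀ x, (c x).Within T)
    (i : Fin (k + 1)) (p : ℤ) :
    (ind fun x => (c x).head i ≤ p) ∈ affSpan (configBits T c) := by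
  by_cases h : -(T : ℤ) ≤ p ∧ p ≤ T
  · exact mem_affSpan (configBits T c) (.inr (i, ⟨p, Finset.mem_Icc.2 h⟩))
  · refine ind_mem_affSpan_of_forall_iff _ _ ((T : ℤ) < p) fun x => ?_
    have := hc x i
    omega

/-- Unary coding makes this a difference of two consecutive bits. -/
theorem ind_head_eq_mem {T : ℕ} {c : X → Config k Γ Q} (hc : ∀ x, (c x).Within T)
    (i : Fin (k + 1)) (p : ℤ) :
    (ind fun x => (c x).head i = p) ∈ affSpan (configBits T c) := by
  have := Submodule.sub_mem _ (ind_head_le_mem hc i p) (ind_head_le_mem hc i (p - 1))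
  convert this using 1
  ext x
  simp only [ind, Pi.sub_apply]
  split_ifs <;> first | omega | norm_num

/-- Exactly `T + 1 - head` of the unary bits are on. -/
theorem head_mem {T : ℕ} {c : X → Config k Γ Q} (hc : ∀ x, (c x).Within T) (i : Fin (k + 1)) :
    (fun x => ((c x).head i : ℝ)) ∈ affSpan (configBits T c) := by
  classical
  have := Submodule.sub_mem _ (const_mem_affSpan (configBits T c) ((T : ℝ) + 1))
    (Submodule.sum_mem _ fun p (_ : p ∈ Finset.Icc (-(T : ℤ)) T) => ind_head_le_mem hc i p)
  convert this using 1
  ext x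
  obtain ⟨h1, h2⟩ := hc x i
  have hf : (Finset.Icc (-(T : ℤ)) T).filter (fun p => (c x).head i ≤ p) =
      Finset.Icc ((c x).head i) T := by
    ext p
    simp only [Finset.mem_filter, Finset.mem_Icc]
    omega
  have hz : (((T : ℤ) + 1 - (c x).head i).toNat : ℤ) = (T : ℤ) + 1 - (c x).head i :=
    Int.toNat_of_nonneg (by omega)
  have hr : (((T : ℤ) + 1 - (c x).head i).toNat : ℝ) = (T : ℝ) + 1 - (c x).head i := by
    exact_mod_cast hz
  have hs : ∑ p ∈ Finset.Icc (-(T : ℤ)) T, (ind fun x => (c x).head i ≤ p) x =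
      (T : ℝ) + 1 - (c x).head i := by
    rw [← hr, ← Int.card_Icc, ← hf, ← Finset.sum_boole]
    exact Finset.sum_congr rfl fun p _ => ind_apply _ x
  rw [Pi.sub_apply, Finset.sum_apply, hs]
  ring

theorem isNeuron_cellBits {T : ℕ} {c : X → Config k Γ Q} (hc : ∀ x, (c x).Within T) (v) :
    IsNeuron (configBits T c) (cellBits T c v) := by
  rcases v with v | ⟨i, p, a⟩
  · obtain ⟨P, hP⟩ := exists_ind_configBits T c v
    have := mem_affSpan (configBits T c) v
    rw [cellBits]
    rw [hP] at this ⊢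
    exact isNeuron_of_ind_mem this
  -- The conjunction of two bits: their sum exceeds 3/2.
  · refine isNeuron_ind (Submodule.sub_mem _
      (Submodule.add_mem _ (mem_affSpan (configBits T c) (.inl (.inr (i, p, a))))
        (ind_head_eq_mem hc i p)) (const_mem_affSpan _ (3 / 2))) fun x => ?_
    by_cases h1 : (c x).tape i p = a <;> by_cases h2 : (c x).head i = p <;>
      simp [configBits, ind, h1, h2] <;> norm_num

/-- The head is in exactly one cell of the window, so summing the marks over cells gives the bit. -/
theorem ind_scan_mem {T : ℕ} {c : X → Config k Γ Q} (hc : ∀ x, (c x).Within T)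
    (i : Fin (k + 1)) (a : Γ) :
    (ind fun x => (c x).scan i = a) ∈ affSpan (cellBits T c) := by
  classical
  have := Submodule.sum_mem _ fun p (_ : p ∈ (Finset.univ : Finset (Pos T))) =>
    mem_affSpan (cellBits T c) (.inr (i, p, a))
  convert this using 1
  ext x
  have hx : (c x).head i ∈ Finset.Icc (-(T : ℤ)) T := Finset.mem_Icc.2 (hc x i)
  rw [Finset.sum_apply, Finset.sum_eq_single ⟨(c x).head i, hx⟩]
  · simp [cellBits, ind_apply, Config.scan]
  · intro p _ hp
    have : (c x).head i ≠ p := fun h => hp (Subtype.ext h.symm)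
    simp [cellBits, ind, this]
  · simp

theorem isNeuron_scanBits {T : ℕ} {c : X → Config k Γ Q} (hc : ∀ x, (c x).Within T) (v) :
    IsNeuron (cellBits T c) (scanBits T c v) := by
  classical
  rcases v with v | ⟨q, s⟩
  · obtain ⟨P, hP⟩ := exists_ind_cellBits T c v
    have := mem_affSpan (cellBits T c) v
    rw [scanBits]
    rw [hP] at this ⊢
    exact isNeuron_of_ind_mem this
  -- A conjunction of `k + 2` bits, one for the state and one per tape; if one fails, the sum is at
  -- most `k + 1`.
  · refine isNeuron_ind (Submodule.sub_mem _
      (Submodule.add_mem _ (mem_affSpan (cellBits T c) (.inl (.inl (.inl q))))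
        (Submodule.sum_mem _ fun i (_ : i ∈ Finset.univ) => ind_scan_mem hc i (s i)))
      (const_mem_affSpan _ ((k : ℝ) + 3 / 2))) fun x => ?_
    simp only [cellBits, configBits, ind, Pi.sub_apply, Pi.add_apply, Finset.sum_apply,
      Finset.sum_boole]
    by_cases hs : (c x).scan = s
    · have : (Finset.univ.filter fun i => (c x).scan i = s i) = Finset.univ := by simp [hs]
      rw [this]
      by_cases h : (c x).state = q <;> simp [h, hs] <;> linarith
    · have : (Finset.univ.filter fun i => (c x).scan i = s i).card < k + 1 := by
        obtain ⟨i, hi⟩ := Function.ne_iff.1 hs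
        simpa using Finset.card_lt_univ_of_notMem
          (s := Finset.univ.filter fun i => (c x).scan i = s i) (x := i) (by simpa using hi)
      have hr : ((Finset.univ.filter fun i => (c x).scan i = s i).card : ℝ) ≤ k := by
        exact_mod_cast Nat.lt_succ_iff.1 this
      simp only [hs, and_false, iff_false, not_lt]
      split_ifs <;> linarith

/-- The pair bits are one-hot, so every real function of the pair is a linear combination of them.
-/
theorem comp_scan_mem [Fintype Γ] [Fintype Q] (T : ℕ) (c : X → Config k Γ Q)
    (φ : Q → (Fin (k + 1) → Γ) → ℝ) :
    (fun x => φ (c x).state (c x).scan) ∈ affSpan (scanBits T c) := by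
  classical
  have := Submodule.sum_mem _ fun v (_ : v ∈ (Finset.univ : Finset (Q × (Fin (k + 1) → Γ)))) =>
    Submodule.smul_mem _ (φ v.1 v.2) (mem_affSpan (scanBits T c) (.inr v))
  convert this using 1
  ext x
  rw [Finset.sum_apply, Finset.sum_eq_single ((c x).state, (c x).scan)]
  · simp [scanBits, ind]
  · rintro ⟨q, s⟩ _ h
    have : ¬ ((c x).state = q ∧ (c x).scan = s) := fun h' => h (Prod.ext h'.1.symm h'.2.symm)
    simp [scanBits, ind, this]
  · simp

/-! ### The operation of a machine -/

open Classical in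
/-- The transition function, extended by doing nothing in a halting state. -/
noncomputable def haltingTransition (M : TuringMachine k Γ Q) (q : Q) (s : Fin (k + 1) → Γ) :
    Q × (Fin (k + 1) → Γ × HeadMove) :=
  if q = M.accept ∨ q = M.reject then (q, fun i => (s i, .stay)) else M.transition q s

theorem step_state (M : TuringMachine k Γ Q) (C : Config k Γ Q) :
    (M.step C).state = (M.haltingTransition C.state C.scan).1 := by
  unfold step haltingTransition Config.scan
  split_ifs <;> rfl

theorem step_head (M : TuringMachine k Γ Q) (C : Config k Γ Q) (i : Fin (k + 1)) :
    (M.step C).head i = C.head i + ((M.haltingTransition C.state C.scan).2 i).2.shift := by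
  unfold step haltingTransition Config.scan
  split_ifs <;> simp [HeadMove.shift]

theorem step_tape (M : TuringMachine k Γ Q) (C : Config k Γ Q) (i : Fin (k + 1)) (p : ℤ) :
    (M.step C).tape i p =
      if C.head i = p then ((M.haltingTransition C.state C.scan).2 i).1 else C.tape i p := by
  unfold step haltingTransition Config.scan
  split_ifs with h1 h2 h2
  · simp [h2]
  · rfl
  · subst h2
    simp
  · simp [Function.update_of_ne (Ne.symm h2)]

theorem Config.Within.step {t : ℕ} {C : Config k Γ Q} (hC : C.Within t)
    (M : TuringMachine k Γ Q) : (M.step C).Within (t + 1) := by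
  intro i
  have h := hC i
  rw [step_head]
  cases ((M.haltingTransition C.state C.scan).2 i).2 <;> simp only [HeadMove.shift] <;>
    push_cast <;> omega

theorem within_iterate_step (M : TuringMachine k Γ Q) {d : ℕ} (x : Fin d → Bool) (t : ℕ) :
    (M.step^[t] (M.init x)).Within t := by
  induction t with
  | zero => intro i; simp [init]
  | succ t ih => rw [Function.iterate_succ_apply']; exact ih.step M

theorem Config.Within.mono {s t : ℕ} (h : s ≤ t) {C : Config k Γ Q} (hC : C.Within s) :
    C.Within t := by
  intro i
  have := hC i
  omega

theorem isNeuron_configBits_step [Fintype Γ] [Fintype Q] (M : TuringMachine k Γ Q) {T : ℕ}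
    {c : X → Config k Γ Q} (hc : ∀ x, (c x).Within T) (v) :
    IsNeuron (scanBits T c) (configBits T (fun x => M.step (c x)) v) := by
  classical
  have hle := (configBits_le_cellBits T c).trans (cellBits_le_scanBits T c)
  rcases v with (q | ⟨i, p, a⟩) | ⟨i, p⟩
  · refine isNeuron_of_ind_mem ?_
    convert comp_scan_mem T c fun r s => if (M.haltingTransition r s).1 = q then 1 else 0 using 1
    ext x
    simp [ind, step_state]
  -- On the scanned cell the doubled difference vanishes and the form equals the bit "`a` is
  -- written". Elsewhere it is `2 * [old symbol is a] + [a is written] - 1`, positive exactly when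
  -- the old symbol is `a`.
  · refine isNeuron_ind (Submodule.sub_mem _ (Submodule.add_mem _ (Submodule.add_mem _
      (Submodule.smul_mem _ (2 : ℝ) (Submodule.sub_mem _
        (hle (mem_affSpan (configBits T c) (.inl (.inr (i, p, a)))))
        (cellBits_le_scanBits T c (mem_affSpan (cellBits T c) (.inr (i, p, a))))))
      (hle (ind_head_eq_mem hc i p)))
      (comp_scan_mem T c fun r s => if ((M.haltingTransition r s).2 i).1 = a then 1 else 0))
      (const_mem_affSpan _ 1)) fun x => ?_
    rw [step_tape]
    by_cases h1 : (c x).head i = p <;> by_cases h2 : (c x).tape i p = a <;>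
      by_cases h3 : ((M.haltingTransition (c x).state (c x).scan).2 i).1 = a <;>
      simp [configBits, cellBits, ind, h1, h2, h3]
  -- For integers, `h + m ≤ p` means `h + m < p + 1/2`.
  · refine isNeuron_ind (Submodule.sub_mem _ (Submodule.sub_mem _
      (const_mem_affSpan _ ((p : ℤ) + 1 / 2 : ℝ)) (hle (head_mem hc i)))
      (comp_scan_mem T c fun r s => (((M.haltingTransition r s).2 i).2.shift : ℝ)))
      fun x => ?_
    rw [step_head]
    simp only [Pi.sub_apply]
    generalize ((M.haltingTransition (c x).state (c x).scan).2 i).2.shift = m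
    generalize (c x).head i = h
    generalize (p : ℤ) = p
    constructor
    · intro hp
      have : ((h + m : ℤ) : ℝ) < ((p + 1 : ℤ) : ℝ) := by push_cast; linarith
      have := Int.cast_lt.1 this
      omega
    · intro hp
      have : ((h + m : ℤ) : ℝ) ≤ p := by exact_mod_cast hp
      push_cast at this
      linarith

theorem isNeuron_configBits_init (M : TuringMachine k Γ Q) (T d : ℕ) (v) :
    IsNeuron (fun (j : Fin d) (x : Fin d → Bool) => bitToReal (x j)) (configBits T M.init v) := by
  classical
  rcases v with (q | ⟨i, p, a⟩) | ⟨i, p⟩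
  · exact isNeuron_of_ind_mem (ind_mem_affSpan_of_forall_iff _ _ (M.start = q) fun x => Iff.rfl)
  · refine isNeuron_of_ind_mem ?_
    by_cases h : i = 0 ∧ (0 : ℤ) ≤ p ∧ (p : ℤ) < d
    · let j : Fin d := ⟨(p : ℤ).toNat, by omega⟩
      -- Any function of one input bit is affine in it.
      let r (b : Bool) : ℝ := if M.symbol (some b) = a then 1 else 0
      have := Submodule.add_mem _ (const_mem_affSpan _ (r false))
        (Submodule.smul_mem _ (r true - r false)
          (mem_affSpan (fun (j : Fin d) (x : Fin d → Bool) => bitToReal (x j)) j))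
      convert this using 1
      ext x
      have hx : (M.init x).tape i p = M.symbol (some (x j)) := dif_pos h
      simp only [ind, hx, Pi.add_apply, Pi.smul_apply, smul_eq_mul]
      cases x j <;> simp [bitToReal, r]
    · refine ind_mem_affSpan_of_forall_iff _ _ (M.symbol none = a) fun x => ?_
      have hx : (M.init x).tape i p = M.symbol none := dif_neg h
      rw [hx]
  · exact isNeuron_of_ind_mem (ind_mem_affSpan_of_forall_iff _ _ ((0 : ℤ) ≤ p) fun x => Iff.rfl)

/-! ### Assembling the network -/

theorem realizes_configBits_pad [Fintype Γ] [Fintype Q] {T W : ℕ} (c : X → Config k Γ Q)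
    (hW : Fintype.card ((Q ⊕ Fin (k + 1) × Pos T × Γ) ⊕ Fin (k + 1) × Pos T) ≤ W) (q : Q) (r : ℕ) :
    Realizes (configBits T c) (List.replicate r W) (ind fun x => (c x).state = q) := by
  have hcopy : ∀ v, IsNeuron (configBits T c) (configBits T c v) := by
    intro v
    obtain ⟨P, hP⟩ := exists_ind_configBits T c v
    have := mem_affSpan (configBits T c) v
    rw [hP] at this ⊢
    exact isNeuron_of_ind_mem this
  induction r with
  | zero => exact (hcopy (.inl (.inl q))).realizes
  | succ r ih => exact ih.cons hW hcopy

theorem realizes_configBits_iterate [Fintype Γ] [Fintype Q] (M : TuringMachine k Γ Q) {T W : ℕ}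
    (hW : Fintype.card ((((Q ⊕ Fin (k + 1) × Pos T × Γ) ⊕ Fin (k + 1) × Pos T) ⊕
      Fin (k + 1) × Pos T × Γ) ⊕ Q × (Fin (k + 1) → Γ)) ≤ W) (q : Q) (r n : ℕ)
    (c : X → Config k Γ Q) (hc : ∀ s ≤ n, ∀ x, (M.step^[s] (c x)).Within T) :
    Realizes (configBits T c) (List.replicate (3 * n + r) W)
      (ind fun x => (M.step^[n] (c x)).state = q) := by
  have hW2 : Fintype.card (((Q ⊕ Fin (k + 1) × Pos T × Γ) ⊕ Fin (k + 1) × Pos T) ⊕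
      Fin (k + 1) × Pos T × Γ) ≤ W :=
    (Fintype.card_le_of_injective _ Sum.inl_injective).trans hW
  have hW1 : Fintype.card ((Q ⊕ Fin (k + 1) × Pos T × Γ) ⊕ Fin (k + 1) × Pos T) ≤ W :=
    (Fintype.card_le_of_injective _ Sum.inl_injective).trans hW2
  induction n generalizing c with
  | zero => simpa using realizes_configBits_pad c hW1 q r
  | succ n ih =>
    have h0 : ∀ x, (c x).Within T := hc 0 (Nat.zero_le _)
    have := ih (fun x => M.step (c x)) fun s hs => hc (s + 1) (by omega)
    rw [show 3 * (n + 1) + r = 3 * n + r + 1 + 1 + 1 by ring]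
    exact ((this.cons hW1 (isNeuron_configBits_step M h0)).cons hW (isNeuron_scanBits h0)).cons
      hW2 (isNeuron_cellBits h0)

/-- Halting configurations are fixed by `step`, so running for the full time bound is harmless. -/
theorem ComputesWithin.state_iterate {M : TuringMachine k Γ Q} {d : ℕ}
    {f : (Fin d → Bool) → Bool} {t : ℕ} (h : M.ComputesWithin f t) (x : Fin d → Bool) :
    (M.step^[t] (M.init x)).state = if f x then M.accept else M.reject := by
  obtain ⟨s, hs, hx⟩ := h x
  have hfix : M.step (M.step^[s] (M.init x)) = M.step^[s] (M.init x) := by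
    refine if_pos ?_
    rw [hx]
    cases f x <;> simp
  obtain ⟨u, rfl⟩ := Nat.exists_eq_add_of_le' hs
  rw [Function.iterate_add_apply, Function.iterate_fixed hfix, hx]

end TuringMachine

theorem mainTheorem7 (T : ℕ → ℕ) (k : ℕ) (Γ Q : Type) [Finite Γ] [Finite Q] :
    ∃ b c : ℕ, 0 < b ∧ 0 < c ∧ ∀ d : ℕ, ∃ A : NetworkArchitecture,
      A.depth = c * T d + b ∧ A.size = (c * T d + b) ^ 2 ∧
        turingFunctions k Γ Q T d ⊆ A.hypothesisClass thresholdActivation d := by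
  classical
  have := Fintype.ofFinite Γ
  have := Fintype.ofFinite Q
  -- `K * (2 * t + 1)` bounds the number of bits in the widest layer.
  obtain ⟨K, hK⟩ : ∃ K, K = Fintype.card Q + 2 * ((k + 1) * Fintype.card Γ) + (k + 1) +
      Fintype.card Q * Fintype.card Γ ^ (k + 1) := ⟨_, rfl⟩
  refine ⟨K + 2, 2 * K + 3, by omega, by omega, fun d => ?_⟩
  generalize hT : T d = t
  -- Hidden layers: one encodes the input, `3 * t` simulate, `K * (2 * t + 1)` only copy. The copies
  -- make `D` large enough that width `D + 2` holds all bits, and `D * (D + 2) + 1 = (D + 1) ^ 2`.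
  obtain ⟨D, hD⟩ : ∃ D, D = 3 * t + (2 * K * t + K) + 1 := ⟨_, rfl⟩
  have hD' : (2 * K + 3) * t + (K + 2) = D + 1 := by rw [hD]; ring
  rw [hD']
  refine ⟨⟨List.replicate D (D + 2), fun n hn => by rw [List.eq_of_mem_replicate hn]; omega⟩,
    by simp [NetworkArchitecture.depth], ?_, ?_⟩
  · simp only [NetworkArchitecture.size, List.sum_replicate, smul_eq_mul]
    ring
  rintro f ⟨M, hM⟩
  rw [hT] at hM
  have hP : Fintype.card (TuringMachine.Pos t) = 2 * t + 1 := by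
    rw [Fintype.card_coe, Int.card_Icc]
    omega
  have hW : Fintype.card ((((Q ⊕ Fin (k + 1) × TuringMachine.Pos t × Γ) ⊕
      Fin (k + 1) × TuringMachine.Pos t) ⊕ Fin (k + 1) × TuringMachine.Pos t × Γ) ⊕
        Q × (Fin (k + 1) → Γ)) ≤ D + 2 := by
    simp only [Fintype.card_sum, Fintype.card_prod, Fintype.card_fin, hP, Fintype.card_fun]
    have h1 : K * (2 * t + 1) ≤ D + 2 := by rw [hD]; ring_nf; omega
    refine le_trans ?_ h1
    rw [hK]
    have h2 : Fintype.card Q ≤ Fintype.card Q * (2 * t + 1) := Nat.le_mul_of_pos_right _ (by omega)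
    have h3 : Fintype.card Q * Fintype.card Γ ^ (k + 1) ≤
        Fintype.card Q * Fintype.card Γ ^ (k + 1) * (2 * t + 1) :=
      Nat.le_mul_of_pos_right _ (by omega)
    linarith
  have hR := (TuringMachine.realizes_configBits_iterate M hW M.accept (2 * K * t + K) t
    (M.init (d := d)) fun s hs x => (M.within_iterate_step x s).mono hs).cons
    ((Fintype.card_le_of_injective _
      (Sum.inl_injective.comp Sum.inl_injective)).trans hW) (M.isNeuron_configBits_init t d)
  rw [← List.replicate_succ, ← hD] at hR
  obtain ⟨N, hN⟩ := hR d _ le_rfl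
  refine ⟨N, fun x => (hN x).trans ?_⟩
  have hx := hM.state_iterate x
  cases hf : f x <;> simp [ind, bitToReal, hx, hf, M.accept_ne_reject.symm]
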